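/- Let $\mathcal X\subseteq\mathbb R^{N_1}$ be arbitrary, let $c\in\mathbb R^{N_1}$, $q\in\mathbb R^{N_2}$, $W\in\mathbb R^{M\times N_2}$, and let $T(x)\in\mathbb R^{M\times K}$ and $h(x)\in\mathbb R^M$ depend affinely on $x\in\mathbb R^{N_1}$. For $x\in\mathbb R^{N_1}$ and $\xi\in\mathbb R^K$ let $$Z(x,\xi)=\inf\{q^\top y:\ y\in\mathbb R^{N_2},\ T(x)\xi+h(x)\le Wy\}\in[-\infty,+\infty]$$ (so the objective of the recourse problem is unaffected by the uncertainty, i.e. $Q=0$). Assume sufficiently expensive recourse, i.e. that the dual of the recourse problem is feasible: there is $p\in\mathbb R^M_+$ with $W^\top p=q$. Let $w_+,w_->0$, $\|\xi\|=\sum_{k=1}^K\max\{w_+\xi_k,-w_-\xi_k\}$, let $\hat{\xi}_1,\dots,\hat{\xi}_I\in\mathbb R^K$ with $I\ge1$, $\hat{\mathbb P}_I=\frac1I\sum_{i=1}^I\delta_{\hat{\xi}_i}$, and let $\epsilon>0$. Let $\hat{\mathcal P}$ be the set of all Borel probability measures $\mathbb P$ on $\mathbb R^K$ with finite first moment and $W^1(\mathbb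 P,\hat{\mathbb P}_I)\le\epsilon$, where $W^1(\mathbb P,\hat{\mathbb P}_I)$ is the infimum of $\int\|\xi_1-\xi_2\|\,\mathbb Q(\mathrm d\xi_1,\mathrm d\xi_2)$ over all couplings $\mathbb Q$ with first marginal $\mathbb P$ and second marginal $\hat{\mathbb P}_I$. Then the two-stage distributionally robust problem $$\text{minimize}\quad c^\top x+\sup_{\mathbb P\in\hat{\mathcal P}}\mathbb E_{\mathbb P}[Z(x,\tilde{\xi})]\qquad\text{subject to}\quad x\in\mathcal X\tag{1}$$ is equivalent to the linear program $$\begin{array}{lll}\text{minimize}&c^\top x+\epsilon\lambda+\frac1I\sum_{i=1}^Iq^\top y_i\\ \text{subject to}&x\in\mathcal X,\ \lambda\in\mathbb R_+,\ y_i\in\mathbb R^{N_2}\ (i\le I),\ \phi_k,\psi_k\in\mathbb R^{N_2}\ (k\le K)\\&T(x)\hat{\xi}_i+h(x)\le Wy_i&\forall i\le I\\&q^\top\phi_k\le\lambda,\quad q^\top\psi_k\le\lambda&\forall k\le K\\&T(x)\mathbf e_k/w_+\le W\phi_k,\quad-T(x)\mathbf e_k/w_-\le W\psi_k&\forall k\le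 K\end{array}\tag{2}$$ in the following sense. For every $x\in\mathcal X$ the objective value of $x$ in (1) equals, in $[-\infty,+\infty]$, the infimum of (2) over the remaining variables with $x$ fixed (the infimum over the empty set being $+\infty$), and this infimum is attained whenever it is not $+\infty$; the optimal values of (1) and (2) coincide; and $x$ is an optimal solution of finite cost of (1) if and only if $(x,\lambda,(y_i),(\phi_k),(\psi_k))$ is an optimal solution of (2) for some $\lambda,y_i,\phi_k,\psi_k$. Moreover, (2) has polynomial size: its objective is a linear function of $N_1+1+IN_2+2KN_2$ real variables, and its constraints other than $x\in\mathcal X$ form a system of $1+IM+2K(1+M)$ linear inequalities in these variables; in particular, if $\mathcal X$ is given by $m_0$ linear inequalities, then (2) is a linear program with these variables and $m_0+1+IM+2K(1+M)$ linear inequality constraints. -/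

import Mathlib

open MeasureTheory Matrix
open scoped ENNReal

noncomputable section

namespace TwoStage

/-- The reference distance `d(ξ₁, ξ₂) = ‖ξ₁ - ξ₂‖` with `‖ξ‖ = ∑ₖ max {w₊ ξₖ, -w₋ ξₖ}`. -/
def weightedDist {K : ℕ} (wp wm : ℝ) (ξ₁ ξ₂ : Fin K → ℝ) : ℝ :=
  ∑ k, max (wp * (ξ₁ - ξ₂) k) (-wm * (ξ₁ - ξ₂) k)

/-- The set of probability distributions supported on `Ξ` with finite `r`-th moment with respect
to `d`. -/
def momentClass {K : ℕ} (Ξ : Set (Fin K → ℝ)) (d : (Fin K → ℝ) → (Fin K → ℝ) → ℝ) (r : ℝ) :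
    Set (Measure (Fin K → ℝ)) :=
  {P | IsProbabilityMeasure P ∧ (∀ᵐ ξ ∂P, ξ ∈ Ξ) ∧
    ∃ ξ₀ ∈ Ξ, ∫⁻ ξ, ENNReal.ofReal (d ξ ξ₀) ^ r ∂P < ⊤}

/-- The `r`-Wasserstein distance: the infimum of the transportation costs over all couplings. -/
def wasserstein {K : ℕ} (d : (Fin K → ℝ) → (Fin K → ℝ) → ℝ) (r : ℝ)
    (P₁ P₂ : Measure (Fin K → ℝ)) : ℝ≥0∞ :=
  ⨅ π ∈ {π : Measure ((Fin K → ℝ) × (Fin K → ℝ)) |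
      π.map Prod.fst = P₁ ∧ π.map Prod.snd = P₂},
    (∫⁻ z, ENNReal.ofReal (d z.1 z.2) ^ r ∂π) ^ (1 / r)

/-- The ball of all distributions in the moment class whose distance to `P₀` is at most `ε`. -/
def wassersteinBall {K : ℕ} (Ξ : Set (Fin K → ℝ)) (d : (Fin K → ℝ) → (Fin K → ℝ) → ℝ) (r : ℝ)
    (P₀ : Measure (Fin K → ℝ)) (ε : ℝ) : Set (Measure (Fin K → ℝ)) :=
  {P | P ∈ momentClass Ξ d r ∧ wasserstein d r P P₀ ≤ ENNReal.ofReal ε}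

/-- The uniform distribution on the samples. -/
def empirical {K I : ℕ} (ξs : Fin I → Fin K → ℝ) : Measure (Fin K → ℝ) :=
  (I : ℝ≥0∞)⁻¹ • ∑ i, Measure.dirac (ξs i)

/-- The expectation of an extended-real-valued function: the integral of the positive part minus
the integral of the negative part. -/
def expectation {α : Type*} [MeasurableSpace α] (P : Measure α) (f : α → EReal) : EReal :=
  ((∫⁻ a, (f a).toENNReal ∂P : ℝ≥0∞) : EReal) - ((∫⁻ a, (-f a).toENNReal ∂P : ℝ≥0∞) : EReal)

/-- The data of a two-stage distributionally robust linear program with `N₁` here-and-now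
decisions, `N₂` wait-and-see decisions, `M` recourse constraints, `K` uncertain parameters. -/
structure Problem (N₁ N₂ M K : ℕ) where
  /-- feasible set of the here-and-now decisions -/
  X : Set (Fin N₁ → ℝ)
  /-- support set of the uncertain parameters -/
  Ξ : Set (Fin K → ℝ)
  c : Fin N₁ → ℝ
  Q : Matrix (Fin N₂) (Fin K) ℝ
  q : Fin N₂ → ℝ
  W : Matrix (Fin M) (Fin N₂) ℝ
  T : (Fin N₁ → ℝ) →ᵃ[ℝ] Matrix (Fin M) (Fin K) ℝ
  h : (Fin N₁ → ℝ) →ᵃ[ℝ] (Fin M → ℝ)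

namespace Problem

variable {N₁ N₂ M K I : ℕ} (D : Problem N₁ N₂ M K)

/-- The optimal value of the recourse problem (`+∞` if it is infeasible, `-∞` if it is
unbounded). -/
def recourse (x : Fin N₁ → ℝ) (ξ : Fin K → ℝ) : EReal :=
  ⨅ y ∈ {y : Fin N₂ → ℝ | D.T x *ᵥ ξ + D.h x ≤ D.W *ᵥ y}, (((D.Q *ᵥ ξ + D.q) ⬝ᵥ y : ℝ) : EReal)

/-- For every `ξ ∈ Ξ` the dual of the recourse problem is feasible. -/
def SufficientlyExpensiveRecourse : Prop :=
  ∀ ξ ∈ D.Ξ, ∃ p : Fin M → ℝ, 0 ≤ p ∧ D.Q *ᵥ ξ + D.q = D.Wᵀ *ᵥ p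

/-- The worst-case expected wait-and-see cost over the ambiguity set `Amb`. -/
def worstCase (Amb : Set (Measure (Fin K → ℝ))) (x : Fin N₁ → ℝ) : EReal :=
  ⨆ P ∈ Amb, expectation P (D.recourse x)

/-- The objective function of the distributionally robust problem. -/
def objective (Amb : Set (Measure (Fin K → ℝ))) (x : Fin N₁ → ℝ) : EReal :=
  ((D.c ⬝ᵥ x : ℝ) : EReal) + D.worstCase Amb x

/-- `x` is an optimal solution of the distributionally robust problem (solutions of infinite
cost do not count). -/
def IsOptimal (Amb : Set (Measure (Fin K → ℝ))) (x : Fin N₁ → ℝ) : Prop :=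
  x ∈ D.X ∧ D.objective Amb x ≠ ⊤ ∧ ∀ x' ∈ D.X, D.objective Amb x ≤ D.objective Amb x'

/-- The decision variables `(x, λ, y, φ, ψ)` of the linear program. -/
abbrev LPVar (N₁ N₂ K I : ℕ) : Type :=
  (Fin N₁ → ℝ) × ℝ × (Fin I → Fin N₂ → ℝ) × (Fin K → Fin N₂ → ℝ) × (Fin K → Fin N₂ → ℝ)

/-- The constraints of the linear program other than `x ∈ X`. -/
def LPConstraints (wp wm : ℝ) (ξs : Fin I → Fin K → ℝ) : LPVar N₁ N₂ K I → Prop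
  | (x, lam, y, φ, ψ) =>
    0 ≤ lam ∧
    (∀ i, D.T x *ᵥ ξs i + D.h x ≤ D.W *ᵥ y i) ∧
    ∀ k, D.q ⬝ᵥ φ k ≤ lam ∧ D.q ⬝ᵥ ψ k ≤ lam ∧
      wp⁻¹ • (D.T x *ᵥ Pi.single k 1) ≤ D.W *ᵥ φ k ∧
      -(wm⁻¹ • (D.T x *ᵥ Pi.single k 1)) ≤ D.W *ᵥ ψ k

/-- Feasibility in the linear program. -/
def LPFeasible (wp wm : ℝ) (ξs : Fin I → Fin K → ℝ) (v : LPVar N₁ N₂ K I) : Prop :=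
  v.1 ∈ D.X ∧ D.LPConstraints wp wm ξs v

/-- The objective function `cᵀx + ελ + (1/I) ∑ᵢ qᵀyᵢ` of the linear program. -/
def lpObjective (ε : ℝ) : LPVar N₁ N₂ K I → ℝ
  | (x, lam, y, _, _) => D.c ⬝ᵥ x + ε * lam + (1 / (I : ℝ)) * ∑ i, D.q ⬝ᵥ y i

/-- `v` is an optimal solution of the linear program. -/
def LPOptimal (wp wm : ℝ) (ξs : Fin I → Fin K → ℝ) (ε : ℝ) (v : LPVar N₁ N₂ K I) : Prop :=
  D.LPFeasible wp wm ξs v ∧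
    ∀ v', D.LPFeasible wp wm ξs v' → D.lpObjective ε v ≤ D.lpObjective ε v'

end Problem

end TwoStage

end

/-! Write `d` for the weighted distance and `Z` for the recourse value, with `x` fixed. Both
inequalities rest on how fast `Z` can grow with respect to `d`.

Upper bound: a feasible point of the linear program gives `Z(ξ) ≤ q ⬝ᵥ y i + λ d(ξ, ξs i)`, because
the displacement from the sample can be compensated coordinate by coordinate with nonnegative
multiples of `φ k` and `ψ k`. The minimum over `i` of these bounds grows by at most `λ d`, so
integrating along a nearly optimal coupling bounds the worst case by the sample average plus `λ ε`.

Lower bound: suppose the worst case is a real number `S`, and let `A` be the average of `Z` over the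
samples. Every dual point `p` gives an affine minorant of `Z`. Moving a fraction `β` of each sample
by `(ε / β) v`, where `d(v, 0) = 1`, stays in the ball; as `β → 0` the mass left behind contributes
`A` and the moved mass `ε p ⬝ᵥ (T v)`. Hence `p ⬝ᵥ (T v) ≤ (S - A) / ε` for all dual `p`, and linear
programming duality turns this into a recourse direction of cost at most `(S - A) / ε`. Taking `v =
e_k / w₊` and `v = -e_k / w₋` yields `φ k` and `ψ k`. With `λ = (S - A) / ε` and optimal `y i`, the
linear program attains the value exactly. -/

namespace TwoStage

/-! ### Farkas' lemma and linear programming duality -/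

/-- **Farkas' lemma** for finitely many linear functionals on an arbitrary real vector space. -/
theorem farkas_finset {ι V : Type*} [AddCommGroup V] [Module ℝ V] (s : Finset ι)
    (A : ι → V →ₗ[ℝ] ℝ) (b : V →ₗ[ℝ] ℝ) (hb : ∀ x, (∀ i ∈ s, A i x ≤ 0) → b x ≤ 0) :
    ∃ u : ι → ℝ, 0 ≤ u ∧ b = ∑ i ∈ s, u i • A i := by
  classical
  induction s using Finset.induction_on generalizing A b with
  | empty =>
    refine ⟨0, le_rfl, ?_⟩
    ext x
    have h1 := hb x (by simp)
    have h2 := hb (-x) (by simp)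
    rw [map_neg] at h2
    simpa using le_antisymm h1 (by linarith)
  | insert j s hj ih =>
    by_cases h : ∀ x, (∀ i ∈ s, A i x ≤ 0) → b x ≤ 0
    · obtain ⟨u, hu, hbu⟩ := ih A b h
      refine ⟨Function.update u j 0, ?_, ?_⟩
      · intro i
        by_cases hij : i = j
        · subst hij; simp
        · simpa [hij] using hu i
      · rw [Finset.sum_insert hj, hbu]
        simp only [Function.update_self, zero_smul, zero_add]
        refine Finset.sum_congr rfl fun i hi => ?_
        rw [Function.update_of_ne (by rintro rfl; exact hj hi)]
    · push Not at h
      obtain ⟨x₁, hx₁, hbx₁⟩ := h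
      have hj₁ : 0 < A j x₁ := by
        by_contra hn
        exact absurd (hb x₁ (by
          intro i hi
          rcases Finset.mem_insert.1 hi with rfl | hi
          · exact not_lt.1 hn
          · exact hx₁ i hi)) (not_le.2 hbx₁)
      -- The point violating the reduced implication is normalised so that `A j x₀ = 1`; then `pr`
      -- below projects onto the kernel of `A j` along `x₀`, where constraint `j` holds trivially.
      set x₀ : V := (A j x₁)⁻¹ • x₁ with hx₀
      have hAx₀ : A j x₀ = 1 := by simp [hx₀, hj₁.ne']
      have hsx₀ : ∀ i ∈ s, A i x₀ ≤ 0 := fun i hi => by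
        rw [hx₀, map_smul, smul_eq_mul]
        exact mul_nonpos_of_nonneg_of_nonpos (inv_nonneg.2 hj₁.le) (hx₁ i hi)
      have hbx₀ : 0 ≤ b x₀ := by
        rw [hx₀, map_smul, smul_eq_mul]
        exact mul_nonneg (inv_nonneg.2 hj₁.le) hbx₁.le
      let pr : V →ₗ[ℝ] V := LinearMap.id - (A j).smulRight x₀
      have hpr : ∀ x, pr x = x - A j x • x₀ := fun x => by simp [pr]
      obtain ⟨u, hu, hbu⟩ := ih (fun i => A i ∘ₗ pr) (b ∘ₗ pr) (by
        intro x hx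
        refine hb (pr x) fun i hi => ?_
        rcases Finset.mem_insert.1 hi with rfl | hi
        · simp [hpr, hAx₀]
        · exact hx i hi)
      -- The new multiplier is forced by evaluating the desired identity at `x₀`; it is nonnegative
      -- because `b x₀ ≥ 0` and `A i x₀ ≤ 0` on `s`.
      refine ⟨Function.update u j (b x₀ - ∑ i ∈ s, u i * A i x₀), ?_, ?_⟩
      · intro i
        by_cases hij : i = j
        · subst hij
          have : ∑ i ∈ s, u i * A i x₀ ≤ 0 :=
            Finset.sum_nonpos fun i hi => mul_nonpos_of_nonneg_of_nonpos (hu i) (hsx₀ i hi)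
          simp only [Function.update_self, Pi.zero_apply]
          linarith
        · simpa [hij] using hu i
      · have hs : ∑ i ∈ s, Function.update u j (b x₀ - ∑ i ∈ s, u i * A i x₀) i • A i =
            ∑ i ∈ s, u i • A i := Finset.sum_congr rfl fun i hi => by
          rw [Function.update_of_ne (by rintro rfl; exact hj hi)]
        rw [Finset.sum_insert hj, hs]
        ext x
        have h := LinearMap.congr_fun hbu x
        simp only [LinearMap.comp_apply, hpr, map_sub, map_smul, LinearMap.sum_apply,
          LinearMap.smul_apply, smul_eq_mul, mul_sub, Finset.sum_sub_distrib] at h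
        simp only [Function.update_self, LinearMap.add_apply, LinearMap.smul_apply,
          LinearMap.sum_apply, smul_eq_mul]
        have h' : ∑ i ∈ s, u i * (A j x * A i x₀) = A j x * ∑ i ∈ s, u i * A i x₀ := by
          rw [Finset.mul_sum]
          exact Finset.sum_congr rfl fun i _ => by ring
        rw [h'] at h
        linarith

/-- Linear programming duality with primal attainment: if the dual `Wᵀ p = q`, `p ≥ 0` is feasible
and its value is at most `l`, then some primal feasible point has cost at most `l`. -/
theorem exists_le_mulVec_of_forall_dual_le {m n : ℕ} (W : Matrix (Fin m) (Fin n) ℝ)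
    (b : Fin m → ℝ) (q : Fin n → ℝ) (l : ℝ) (hp : ∃ p : Fin m → ℝ, 0 ≤ p ∧ Wᵀ *ᵥ p = q)
    (hl : ∀ p : Fin m → ℝ, 0 ≤ p → Wᵀ *ᵥ p = q → p ⬝ᵥ b ≤ l) :
    ∃ y : Fin n → ℝ, b ≤ W *ᵥ y ∧ q ⬝ᵥ y ≤ l := by
  obtain ⟨p₀, hp₀, hp₀q⟩ := hp
  -- the homogenized dual variables are pairs `(r, s)` with `Wᵀ r = s q`
  let coord : Fin m → ((Fin m → ℝ) × ℝ) →ₗ[ℝ] ℝ := fun j => LinearMap.proj j ∘ₗ LinearMap.fst ℝ _ _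
  let eqn : Fin n → ((Fin m → ℝ) × ℝ) →ₗ[ℝ] ℝ := fun i =>
    (LinearMap.proj i ∘ₗ Wᵀ.mulVecLin) ∘ₗ LinearMap.fst ℝ _ _ - q i • LinearMap.snd ℝ _ _
  let A : (Fin m ⊕ Unit) ⊕ (Fin n ⊕ Fin n) → ((Fin m → ℝ) × ℝ) →ₗ[ℝ] ℝ :=
    Sum.elim (Sum.elim (fun j => -coord j) fun _ => -LinearMap.snd ℝ _ _)
      (Sum.elim eqn fun i => -eqn i)
  let B : ((Fin m → ℝ) × ℝ) →ₗ[ℝ] ℝ :=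
    (∑ j, b j • coord j) - l • LinearMap.snd ℝ _ _
  have hB : ∀ z, B z = z.1 ⬝ᵥ b - l * z.2 := fun z => by
    simp [B, coord, dotProduct, mul_comm]
  have heqn : ∀ i z, eqn i z = (Wᵀ *ᵥ z.1) i - q i * z.2 := fun i z => rfl
  obtain ⟨u, hu, hBu⟩ := farkas_finset Finset.univ A B (by
    rintro ⟨r, s⟩ h
    have hr : 0 ≤ r := fun j => by
      have := h (Sum.inl (Sum.inl j)) (Finset.mem_univ _)
      simpa [A, coord] using this
    have hs : 0 ≤ s := by
      have := h (Sum.inl (Sum.inr ())) (Finset.mem_univ _)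
      simpa [A] using this
    have he : Wᵀ *ᵥ r = s • q := by
      funext i
      have h1 := h (Sum.inr (Sum.inl i)) (Finset.mem_univ _)
      have h2 := h (Sum.inr (Sum.inr i)) (Finset.mem_univ _)
      simp only [A, Sum.elim_inr, Sum.elim_inl, LinearMap.neg_apply, heqn] at h1 h2
      simp only [Pi.smul_apply, smul_eq_mul]
      linarith
    rw [hB]
    -- If `s = 0`, then `r` is a recession direction of the dual polyhedron, and a positive value
    -- along it would let `p₀ + t r` exceed `l`. If `s > 0`, then `r / s` is dual feasible.
    rcases hs.eq_or_lt with rfl | hs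
    · by_contra hn
      simp only [mul_zero, sub_zero, not_le] at hn
      obtain ⟨t, ht⟩ := exists_nat_gt ((l - p₀ ⬝ᵥ b) / (r ⬝ᵥ b))
      rw [div_lt_iff₀ hn] at ht
      have := hl (p₀ + (t : ℝ) • r) (add_nonneg hp₀ (smul_nonneg t.cast_nonneg hr)) (by
        rw [mulVec_add, mulVec_smul, he, hp₀q]; simp)
      rw [add_dotProduct, smul_dotProduct, smul_eq_mul] at this
      linarith
    · have := hl (s⁻¹ • r) (smul_nonneg (inv_nonneg.2 hs.le) hr) (by
        rw [mulVec_smul, he, smul_smul, inv_mul_cancel₀ hs.ne', one_smul])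
      rw [smul_dotProduct, smul_eq_mul, inv_mul_le_iff₀ hs] at this
      simp only
      linarith)
  -- Each equation entered as two opposite inequalities; the difference of their multipliers is `y`.
  -- Testing the identity at `(e_j, 0)` and `(0, 1)` gives the two claims, the sign multipliers
  -- being the slacks.
  refine ⟨fun i => u (Sum.inr (Sum.inl i)) - u (Sum.inr (Sum.inr i)), fun j => ?_, ?_⟩
  · have h := LinearMap.congr_fun hBu (Pi.single j 1, 0)
    rw [hB] at h
    simp only [Fintype.sum_sum_type, A, Sum.elim_inr, Sum.elim_inl] at h
    have hj := hu (Sum.inl (Sum.inl j))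
    have hv : ∀ i, eqn i (Pi.single j 1, 0) = W j i := fun i => by rw [heqn]; simp
    simp [coord, hv, Pi.single_apply] at h
    simp only [Pi.zero_apply] at hj
    simp only [mulVec, dotProduct, mul_sub, Finset.sum_sub_distrib]
    simp only [mul_comm (W j _)]
    linarith
  · have h := LinearMap.congr_fun hBu (0, 1)
    rw [hB] at h
    simp only [Fintype.sum_sum_type, A, Sum.elim_inr, Sum.elim_inl] at h
    have hj := hu (Sum.inl (Sum.inr ()))
    have hv : ∀ i, eqn i (0, 1) = -q i := fun i => by rw [heqn]; simp
    simp [coord, hv] at h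
    simp only [Pi.zero_apply] at hj
    simp only [dotProduct, mul_sub, Finset.sum_sub_distrib]
    simp only [mul_comm (q _)]
    linarith

/-! ### The weighted distance -/

section WeightedDist

variable {K : ℕ} {wp wm : ℝ}

theorem weightedDist_nonneg (hwp : 0 ≤ wp) (hwm : 0 ≤ wm) (ξ ζ : Fin K → ℝ) :
    0 ≤ weightedDist wp wm ξ ζ := by
  refine Finset.sum_nonneg fun k _ => ?_
  rcases le_total 0 ((ξ - ζ) k) with h | h
  · exact le_max_of_le_left (mul_nonneg hwp h)
  · exact le_max_of_le_right (by nlinarith)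

theorem weightedDist_self (ξ : Fin K → ℝ) : weightedDist wp wm ξ ξ = 0 := by
  simp [weightedDist]

theorem weightedDist_triangle (ξ ζ η : Fin K → ℝ) :
    weightedDist wp wm ξ η ≤ weightedDist wp wm ξ ζ + weightedDist wp wm ζ η := by
  rw [weightedDist, weightedDist, weightedDist, ← Finset.sum_add_distrib]
  refine Finset.sum_le_sum fun k _ => ?_
  simp only [Pi.sub_apply]
  refine max_le ?_ ?_
  · linarith [le_max_left (wp * (ξ k - ζ k)) (-wm * (ξ k - ζ k)),
      le_max_left (wp * (ζ k - η k)) (-wm * (ζ k - η k))]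
  · linarith [le_max_right (wp * (ξ k - ζ k)) (-wm * (ξ k - ζ k)),
      le_max_right (wp * (ζ k - η k)) (-wm * (ζ k - η k))]

theorem weightedDist_add_smul {t : ℝ} (ht : 0 ≤ t) (ξ v : Fin K → ℝ) :
    weightedDist wp wm (ξ + t • v) ξ = t * weightedDist wp wm v 0 := by
  rw [weightedDist, weightedDist, Finset.mul_sum]
  refine Finset.sum_congr rfl fun k _ => ?_
  rw [mul_max_of_nonneg _ _ ht]
  simp only [add_sub_cancel_left, Pi.smul_apply, smul_eq_mul, sub_zero]
  congr 1 <;> ring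

/-- This normalisation is the source of the factors `1 / w₊` and `1 / w₋` in the linear program. -/
theorem weightedDist_single_pos (hwp : 0 < wp) (hwm : 0 < wm) (k : Fin K) :
    weightedDist wp wm (wp⁻¹ • Pi.single k 1) 0 = 1 := by
  rw [weightedDist, Finset.sum_eq_single k]
  · have : 0 < wm * wp⁻¹ := by positivity
    simp only [sub_zero, Pi.smul_apply, Pi.single_eq_same, smul_eq_mul, mul_one]
    rw [mul_inv_cancel₀ hwp.ne', max_eq_left (by linarith)]
  · intro i _ hi
    simp [hi]
  · simp

theorem weightedDist_single_neg (hwp : 0 < wp) (hwm : 0 < wm) (k : Fin K) :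
    weightedDist wp wm (-(wm⁻¹ • Pi.single k 1)) 0 = 1 := by
  rw [weightedDist, Finset.sum_eq_single k]
  · have : 0 < wp * wm⁻¹ := by positivity
    simp only [sub_zero, Pi.neg_apply, Pi.smul_apply, Pi.single_eq_same, smul_eq_mul, mul_one]
    rw [neg_mul_neg, mul_inv_cancel₀ hwm.ne', max_eq_right (by linarith)]
  · intro i _ hi
    simp [hi]
  · simp

theorem continuous_weightedDist :
    Continuous fun z : (Fin K → ℝ) × (Fin K → ℝ) => weightedDist wp wm z.1 z.2 := by
  unfold weightedDist
  fun_prop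

end WeightedDist

end TwoStage

namespace TwoStage

/-! ### Expectations of extended-real functions -/

section Expectation

variable {α : Type*} [MeasurableSpace α] {P : Measure α} {f : α → EReal} {g : α → ℝ}

theorem coe_integral_eq_lintegral_sub (hg : Integrable g P) :
    ((∫ a, g a ∂P : ℝ) : EReal) =
      ((∫⁻ a, ENNReal.ofReal (g a) ∂P : ℝ≥0∞) : EReal) -
        ((∫⁻ a, ENNReal.ofReal (-g a) ∂P : ℝ≥0∞) : EReal) := by
  have hneg : ∫⁻ a, ENNReal.ofReal (-g a) ∂P ≠ ⊤ := hg.neg.lintegral_lt_top.ne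
  rw [integral_eq_lintegral_pos_part_sub_lintegral_neg_part hg, EReal.coe_sub,
    EReal.coe_ennreal_toReal hg.lintegral_lt_top.ne, EReal.coe_ennreal_toReal hneg]

/-- Monotonicity of the lower integral needs no measurability of `f`, so measurability of the
recourse function never has to be shown. -/
theorem expectation_le_integral (hg : Integrable g P) (h : ∀ a, f a ≤ g a) :
    expectation P f ≤ ((∫ a, g a ∂P : ℝ) : EReal) := by
  rw [coe_integral_eq_lintegral_sub hg]
  refine EReal.sub_le_sub ?_ ?_ <;> rw [EReal.coe_ennreal_le_coe_ennreal_iff] <;>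
    refine lintegral_mono fun a => ?_
  · simpa using EReal.toENNReal_le_toENNReal (h a)
  · simpa using EReal.toENNReal_le_toENNReal (EReal.neg_le_neg_iff.2 (h a))

theorem integral_le_expectation (hg : Integrable g P) (h : ∀ a, (g a : EReal) ≤ f a) :
    ((∫ a, g a ∂P : ℝ) : EReal) ≤ expectation P f := by
  rw [coe_integral_eq_lintegral_sub hg]
  refine EReal.sub_le_sub ?_ ?_ <;> rw [EReal.coe_ennreal_le_coe_ennreal_iff] <;>
    refine lintegral_mono fun a => ?_
  · simpa using EReal.toENNReal_le_toENNReal (h a)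
  · simpa using EReal.toENNReal_le_toENNReal (EReal.neg_le_neg_iff.2 (h a))

end Expectation

/-! ### The empirical distribution -/

section Empirical

variable {K I : ℕ}

theorem isProbabilityMeasure_empirical (hI : 0 < I) (ξs : Fin I → Fin K → ℝ) :
    IsProbabilityMeasure (empirical ξs) := by
  refine ⟨?_⟩
  have : (I : ℝ≥0∞) ≠ 0 := by exact_mod_cast hI.ne'
  simp [empirical, Measure.finsetSum_apply, ENNReal.inv_mul_cancel this]

theorem map_empirical {β : Type*} [MeasurableSpace β] {F : (Fin K → ℝ) → β} (hF : Measurable F)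
    (ξs : Fin I → Fin K → ℝ) :
    (empirical ξs).map F = (I : ℝ≥0∞)⁻¹ • ∑ i, Measure.dirac (F (ξs i)) := by
  rw [empirical, Measure.map_smul, Measure.map_finset_sum' hF.aemeasurable]
  simp only [Measure.map_dirac' hF]

/-- No measurability of `g` is required, since singletons are measurable. This admits minorants that
are modified at the sample points. -/
theorem integrable_empirical (hI : 0 < I) (ξs : Fin I → Fin K → ℝ) (g : (Fin K → ℝ) → ℝ) :
    Integrable g (empirical ξs) := by
  have : (I : ℝ≥0∞) ≠ 0 := by exact_mod_cast hI.ne'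
  refine Integrable.smul_measure ?_ (ENNReal.inv_ne_top.2 this)
  exact integrable_finsetSum_measure.2 fun i _ => integrable_dirac (by simp)

theorem integral_empirical (ξs : Fin I → Fin K → ℝ) (g : (Fin K → ℝ) → ℝ) :
    ∫ ξ, g ξ ∂(empirical ξs) = (I : ℝ)⁻¹ * ∑ i, g (ξs i) := by
  rw [empirical, integral_smul_measure, integral_finsetSum_measure]
  · simp
  · exact fun i _ => integrable_dirac (by simp)

theorem lintegral_empirical_const (hI : 0 < I) (ξs : Fin I → Fin K → ℝ) (a : ℝ≥0∞) :
    ∫⁻ _, a ∂(empirical ξs) = a := by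
  have := isProbabilityMeasure_empirical hI ξs
  simp

end Empirical

/-! ### Transport bounds on the Wasserstein ball -/

section Ball

variable {K I : ℕ} {wp wm ε : ℝ}

/-- The perturbation of the empirical distribution that translates a fraction `β` of the mass of
every sample by `v`. -/
noncomputable def partialShift (ξs : Fin I → Fin K → ℝ) (β : ℝ) (v : Fin K → ℝ) :
    Measure (Fin K → ℝ) :=
  ENNReal.ofReal (1 - β) • empirical ξs + ENNReal.ofReal β • empirical fun i => ξs i + v

theorem integrable_partialShift (hI : 0 < I) (ξs : Fin I → Fin K → ℝ) (β : ℝ) (v : Fin K → ℝ)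
    (g : (Fin K → ℝ) → ℝ) : Integrable g (partialShift ξs β v) :=
  ((integrable_empirical hI _ g).smul_measure ENNReal.ofReal_ne_top).add_measure
    ((integrable_empirical hI _ g).smul_measure ENNReal.ofReal_ne_top)

theorem integral_partialShift (hI : 0 < I) (ξs : Fin I → Fin K → ℝ) {β : ℝ} (hβ : 0 ≤ β)
    (hβ1 : β ≤ 1) (v : Fin K → ℝ) (g : (Fin K → ℝ) → ℝ) :
    ∫ ξ, g ξ ∂(partialShift ξs β v) =
      (1 - β) * ((I : ℝ)⁻¹ * ∑ i, g (ξs i)) + β * ((I : ℝ)⁻¹ * ∑ i, g (ξs i + v)) := by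
  rw [partialShift, integral_add_measure
    ((integrable_empirical hI _ g).smul_measure ENNReal.ofReal_ne_top)
    ((integrable_empirical hI _ g).smul_measure ENNReal.ofReal_ne_top),
    integral_smul_measure, integral_smul_measure, integral_empirical, integral_empirical,
    ENNReal.toReal_ofReal hβ, ENNReal.toReal_ofReal (by linarith), smul_eq_mul, smul_eq_mul]

/-- The coupling pairs the unmoved mass with itself and the translated mass with its origin, so its
cost is `β d(v, 0)`. -/
theorem partialShift_mem_wassersteinBall (hI : 0 < I)
    (ξs : Fin I → Fin K → ℝ) {β : ℝ} (hβ : 0 ≤ β) (hβ1 : β ≤ 1) (v : Fin K → ℝ)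
    (hv : β * weightedDist wp wm v 0 ≤ ε) :
    partialShift ξs β v ∈
      wassersteinBall Set.univ (weightedDist wp wm) 1 (empirical ξs) ε := by
  have hprob := isProbabilityMeasure_empirical hI ξs
  have hprob' := isProbabilityMeasure_empirical hI fun i => ξs i + v
  have hsum : ENNReal.ofReal (1 - β) + ENNReal.ofReal β = 1 := by
    rw [← ENNReal.ofReal_add (by linarith) hβ]; simp
  refine ⟨⟨⟨?_⟩, by simp, 0, Set.mem_univ _, ?_⟩, ?_⟩
  · simp [partialShift, hsum]
  · have h := (integrable_partialShift hI ξs β v fun ξ => weightedDist wp wm ξ 0).lintegral_lt_top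
    simpa using h
  · have hm1 : Measurable fun ξ : Fin K → ℝ => (ξ, ξ) := by fun_prop
    have hm2 : Measurable fun ξ : Fin K → ℝ => (ξ + v, ξ) := by fun_prop
    have hshift : (empirical ξs).map (fun ξ => ξ + v) = empirical fun i => ξs i + v :=
      map_empirical (by fun_prop) ξs
    have hd : Measurable fun z : (Fin K → ℝ) × (Fin K → ℝ) =>
        ENNReal.ofReal (weightedDist wp wm z.1 z.2) :=
      continuous_weightedDist.measurable.ennreal_ofReal
    let π : Measure ((Fin K → ℝ) × (Fin K → ℝ)) :=
      ENNReal.ofReal (1 - β) • (empirical ξs).map (fun ξ => (ξ, ξ)) +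
        ENNReal.ofReal β • (empirical ξs).map (fun ξ => (ξ + v, ξ))
    have hπ1 : π.map Prod.fst = partialShift ξs β v := by
      rw [Measure.map_add _ _ measurable_fst, Measure.map_smul, Measure.map_smul,
        Measure.map_map measurable_fst hm1, Measure.map_map measurable_fst hm2]
      simp only [Function.comp_def, Measure.map_id', hshift]
      rfl
    have hπ2 : π.map Prod.snd = empirical ξs := by
      rw [Measure.map_add _ _ measurable_snd, Measure.map_smul, Measure.map_smul,
        Measure.map_map measurable_snd hm1, Measure.map_map measurable_snd hm2]
      simp only [Function.comp_def, Measure.map_id']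
      rw [← add_smul, hsum, one_smul]
    refine (iInf₂_le π ⟨hπ1, hπ2⟩).trans ?_
    · have hdv : ∀ ξ, weightedDist wp wm (ξ + v) ξ = weightedDist wp wm v 0 := fun ξ => by
        simpa using weightedDist_add_smul (wp := wp) (wm := wm) zero_le_one ξ v
      simp only [ENNReal.rpow_one, div_one, π, lintegral_add_measure, lintegral_smul_measure,
        lintegral_map hd hm1, lintegral_map hd hm2, weightedDist_self, hdv]
      rw [lintegral_empirical_const hI, lintegral_empirical_const hI]
      simp only [ENNReal.ofReal_zero, mul_zero, zero_add, smul_eq_mul]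
      rw [← ENNReal.ofReal_mul hβ]
      exact ENNReal.ofReal_le_ofReal hv

/-- The moment class provides a single base point; the triangle inequality passes to any other. -/
theorem integrable_weightedDist_of_mem_momentClass (hwp : 0 ≤ wp) (hwm : 0 ≤ wm)
    {P : Measure (Fin K → ℝ)} (hP : P ∈ momentClass Set.univ (weightedDist wp wm) 1)
    (ζ : Fin K → ℝ) : Integrable (fun ξ => weightedDist wp wm ξ ζ) P := by
  obtain ⟨hprob, -, ξ₀, -, h⟩ := hP
  have hc : ∀ η : Fin K → ℝ, Continuous fun ξ => weightedDist wp wm ξ η := fun η =>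
    continuous_weightedDist.comp (by fun_prop : Continuous fun ξ : Fin K → ℝ => (ξ, η))
  have h₀ : Integrable (fun ξ => weightedDist wp wm ξ ξ₀) P := by
    refine ⟨(hc ξ₀).aestronglyMeasurable, ?_⟩
    rw [hasFiniteIntegral_iff_ofReal (ae_of_all _ fun ξ => weightedDist_nonneg hwp hwm _ _)]
    simpa using h
  refine (h₀.add (integrable_const (weightedDist wp wm ξ₀ ζ))).mono'
    (hc ζ).aestronglyMeasurable (ae_of_all _ fun ξ => ?_)
  rw [Real.norm_of_nonneg (weightedDist_nonneg hwp hwm _ _)]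
  exact weightedDist_triangle _ _ _

/-- The easy half of Kantorovich duality: a bound `g(ξ) ≤ g(ζ) + l d(ξ, ζ)` controls the expectation
of `g` over the ball. -/
theorem integral_le_of_mem_wassersteinBall (hI : 0 < I) (hwp : 0 ≤ wp) (hwm : 0 ≤ wm)
    (hε : 0 ≤ ε) (ξs : Fin I → Fin K → ℝ) {P : Measure (Fin K → ℝ)}
    (hP : P ∈ wassersteinBall Set.univ (weightedDist wp wm) 1 (empirical ξs) ε)
    {g : (Fin K → ℝ) → ℝ} (hgc : Continuous g) (hg : Integrable g P) {l : ℝ} (hl : 0 ≤ l)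
    (hlip : ∀ ξ ζ, g ξ ≤ g ζ + l * weightedDist wp wm ξ ζ) :
    ∫ ξ, g ξ ∂P ≤ (I : ℝ)⁻¹ * ∑ i, g (ξs i) + l * ε := by
  obtain ⟨-, hW⟩ := hP
  refine le_of_forall_pos_le_add fun δ hδ => ?_
  -- The infimum over couplings need not be known to be attained, hence the slack; dividing by `l +
  -- 1` covers `l = 0`.
  have hδ' : 0 < δ / (l + 1) := by positivity
  have hlt : wasserstein (weightedDist wp wm) 1 P (empirical ξs) <
      ENNReal.ofReal (ε + δ / (l + 1)) :=
    hW.trans_lt ((ENNReal.ofReal_lt_ofReal_iff (by linarith)).2 (by linarith))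
  simp only [wasserstein, iInf_lt_iff] at hlt
  obtain ⟨π, ⟨hπ1, hπ2⟩, hπ⟩ := hlt
  simp only [ENNReal.rpow_one, div_one] at hπ
  have hd0 : 0 ≤ᵐ[π] fun z => weightedDist wp wm z.1 z.2 :=
    ae_of_all _ fun z => weightedDist_nonneg hwp hwm _ _
  have hdi : Integrable (fun z => weightedDist wp wm z.1 z.2) π := by
    refine ⟨continuous_weightedDist.aestronglyMeasurable, ?_⟩
    rw [hasFiniteIntegral_iff_ofReal hd0]
    exact hπ.trans ENNReal.ofReal_lt_top
  have hdle : ∫ z, weightedDist wp wm z.1 z.2 ∂π ≤ ε + δ / (l + 1) := by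
    rw [integral_eq_lintegral_of_nonneg_ae hd0 continuous_weightedDist.aestronglyMeasurable]
    exact ENNReal.toReal_le_of_le_ofReal (by positivity) hπ.le
  have hg1 : Integrable (fun z : (Fin K → ℝ) × (Fin K → ℝ) => g z.1) π := by
    rw [← hπ1] at hg
    exact hg.comp_measurable measurable_fst
  have hg2 : Integrable (fun z : (Fin K → ℝ) × (Fin K → ℝ) => g z.2) π := by
    have := integrable_empirical hI ξs g
    rw [← hπ2] at this
    exact this.comp_measurable measurable_snd
  calc ∫ ξ, g ξ ∂P = ∫ z, g z.1 ∂π := by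
        rw [← hπ1, integral_map measurable_fst.aemeasurable hgc.aestronglyMeasurable]
    _ ≤ ∫ z, (g z.2 + l * weightedDist wp wm z.1 z.2) ∂π :=
        integral_mono hg1 (hg2.add (hdi.const_mul l)) fun z => hlip _ _
    _ = ∫ z, g z.2 ∂π + l * ∫ z, weightedDist wp wm z.1 z.2 ∂π := by
        rw [integral_add hg2 (hdi.const_mul l), integral_const_mul]
    _ = (I : ℝ)⁻¹ * ∑ i, g (ξs i) + l * ∫ z, weightedDist wp wm z.1 z.2 ∂π := by
        rw [← integral_empirical, ← hπ2,
          integral_map measurable_snd.aemeasurable hgc.aestronglyMeasurable]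
    _ ≤ (I : ℝ)⁻¹ * ∑ i, g (ξs i) + l * (ε + δ / (l + 1)) := by gcongr
    _ ≤ (I : ℝ)⁻¹ * ∑ i, g (ξs i) + l * ε + δ := by
        have : l * (δ / (l + 1)) ≤ δ := by
          rw [← mul_div_assoc, div_le_iff₀ (by positivity)]
          nlinarith
        linarith

end Ball

end TwoStage

namespace TwoStage

/-! ### Bounds between the worst case and the linear program -/

namespace Problem

variable {N₁ N₂ M K I : ℕ} (D : Problem N₁ N₂ M K) {wp wm ε : ℝ}

theorem recourse_le (hQ : D.Q = 0) {x : Fin N₁ → ℝ} {ξ : Fin K → ℝ} {y : Fin N₂ → ℝ}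
    (hy : D.T x *ᵥ ξ + D.h x ≤ D.W *ᵥ y) : D.recourse x ξ ≤ ((D.q ⬝ᵥ y : ℝ) : EReal) := by
  refine (iInf₂_le y hy).trans ?_
  simp [hQ]

/-- Weak duality for the recourse problem. -/
theorem le_recourse (hQ : D.Q = 0) {p : Fin M → ℝ} (hp : 0 ≤ p) (hpq : D.Wᵀ *ᵥ p = D.q)
    (x : Fin N₁ → ℝ) (ξ : Fin K → ℝ) :
    ((p ⬝ᵥ (D.T x *ᵥ ξ + D.h x) : ℝ) : EReal) ≤ D.recourse x ξ := by
  refine le_iInf₂ fun y hy => ?_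
  rw [EReal.coe_le_coe_iff, hQ, zero_mulVec, zero_add, ← hpq, mulVec_transpose,
    ← dotProduct_mulVec]
  exact dotProduct_le_dotProduct_of_nonneg_left hy hp

/-- A feasible point of the linear program yields an upper bound on the recourse function around
every sample. -/
theorem recourse_le_add_weightedDist (hQ : D.Q = 0) (hwp : 0 < wp) (hwm : 0 < wm)
    {ξs : Fin I → Fin K → ℝ} {x : Fin N₁ → ℝ} {l : ℝ} {y : Fin I → Fin N₂ → ℝ}
    {φ ψ : Fin K → Fin N₂ → ℝ} (h : D.LPConstraints wp wm ξs (x, l, y, φ, ψ))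
    (ξ : Fin K → ℝ) (i : Fin I) :
    D.recourse x ξ ≤ ((D.q ⬝ᵥ y i + l * weightedDist wp wm ξ (ξs i) : ℝ) : EReal) := by
  obtain ⟨hl, hy, hk⟩ := h
  let δ : Fin K → ℝ := ξ - ξs i
  -- For each `k` at most one coefficient is nonzero, according to the sign of `δ k`. Their sum over
  -- `k` is the distance, and each unit costs at most `l`.
  let z : Fin N₂ → ℝ := ∑ k, (max (wp * δ k) 0 • φ k + max (-wm * δ k) 0 • ψ k)
  have hT : D.T x *ᵥ δ ≤ D.W *ᵥ z := by
    have h1 : D.T x *ᵥ δ = ∑ k, δ k • (D.T x *ᵥ Pi.single k 1) := by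
      conv_lhs => rw [← Finset.univ_sum_single δ]
      rw [mulVec_sum]
      refine Finset.sum_congr rfl fun k _ => ?_
      rw [← mulVec_smul, ← Pi.single_smul, smul_eq_mul, mul_one]
    rw [h1, mulVec_sum]
    refine Finset.sum_le_sum fun k _ => ?_
    obtain ⟨-, -, hφ, hψ⟩ := hk k
    rw [mulVec_add, mulVec_smul, mulVec_smul]
    rcases le_total 0 (δ k) with hδ | hδ
    · rw [max_eq_left (mul_nonneg hwp.le hδ), max_eq_right (by nlinarith), zero_smul, add_zero]
      refine le_trans (le_of_eq ?_) (smul_le_smul_of_nonneg_left hφ (mul_nonneg hwp.le hδ))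
      rw [smul_smul]
      congr 1
      field_simp
    · rw [max_eq_right (mul_nonpos_of_nonneg_of_nonpos hwp.le hδ),
        max_eq_left (by nlinarith), zero_smul, zero_add]
      refine le_trans (le_of_eq ?_) (smul_le_smul_of_nonneg_left hψ
        (by nlinarith : 0 ≤ -wm * δ k))
      rw [smul_neg, smul_smul, ← neg_smul]
      congr 1
      field_simp
  have hq : D.q ⬝ᵥ z ≤ l * weightedDist wp wm ξ (ξs i) := by
    rw [dotProduct_sum, weightedDist, Finset.mul_sum]
    refine Finset.sum_le_sum fun k _ => ?_
    obtain ⟨hφ, hψ, -, -⟩ := hk k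
    rw [dotProduct_add, dotProduct_smul, dotProduct_smul, smul_eq_mul, smul_eq_mul]
    change _ ≤ l * max (wp * δ k) (-wm * δ k)
    rcases le_total 0 (δ k) with hδ | hδ
    · have h1 : 0 ≤ wp * δ k := mul_nonneg hwp.le hδ
      have h2 : -wm * δ k ≤ 0 := by nlinarith
      rw [max_eq_left h1, max_eq_right h2, max_eq_left (h2.trans h1)]
      nlinarith
    · have h1 : wp * δ k ≤ 0 := mul_nonpos_of_nonneg_of_nonpos hwp.le hδ
      have h2 : 0 ≤ -wm * δ k := by nlinarith
      rw [max_eq_right h1, max_eq_left h2, max_eq_right (h1.trans h2)]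
      nlinarith
  have hfeas : D.T x *ᵥ ξ + D.h x ≤ D.W *ᵥ (y i + z) := by
    have h1 : D.T x *ᵥ ξ = D.T x *ᵥ ξs i + D.T x *ᵥ δ := by
      rw [← mulVec_add]
      simp [δ]
    rw [h1, mulVec_add, add_right_comm]
    exact add_le_add (hy i) hT
  refine (D.recourse_le hQ hfeas).trans (EReal.coe_le_coe_iff.2 ?_)
  rw [dotProduct_add]
  linarith

/-- Every feasible point of the linear program bounds the objective from above. -/
theorem objective_le_lpObjective (hI : 0 < I) (hQ : D.Q = 0) (hwp : 0 < wp) (hwm : 0 < wm)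
    (hε : 0 ≤ ε) {ξs : Fin I → Fin K → ℝ} {v : LPVar N₁ N₂ K I}
    (h : D.LPConstraints wp wm ξs v) :
    D.objective (wassersteinBall Set.univ (weightedDist wp wm) 1 (empirical ξs) ε) v.1 ≤
      ((D.lpObjective ε v : ℝ) : EReal) := by
  obtain ⟨x, l, y, φ, ψ⟩ := v
  have hl : 0 ≤ l := h.1
  have hne : (Finset.univ : Finset (Fin I)).Nonempty := ⟨⟨0, hI⟩, Finset.mem_univ _⟩
  let G : Fin I → (Fin K → ℝ) → ℝ := fun i ξ => D.q ⬝ᵥ y i + l * weightedDist wp wm ξ (ξs i)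
  -- The minimum still dominates the recourse value, is at most `q ⬝ᵥ y i` at sample `i`, and
  -- inherits the one-sided Lipschitz bound from the triangle inequality.
  let g : (Fin K → ℝ) → ℝ := fun ξ => Finset.univ.inf' hne fun i => G i ξ
  have hGc : ∀ i, Continuous (G i) := fun i =>
    continuous_const.add (continuous_const.mul
      (continuous_weightedDist.comp (by fun_prop : Continuous fun ξ : Fin K → ℝ => (ξ, ξs i))))
  have hgc : Continuous g := Continuous.finset_inf'_apply hne fun i _ => hGc i
  have hgG : ∀ i ξ, g ξ ≤ G i ξ := fun i ξ => Finset.inf'_le _ (Finset.mem_univ i)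
  have hlip : ∀ ξ ζ, g ξ ≤ g ζ + l * weightedDist wp wm ξ ζ := fun ξ ζ => by
    obtain ⟨i, -, hi⟩ := Finset.exists_mem_eq_inf' hne fun i => G i ζ
    have h1 := hgG i ξ
    have h2 := mul_le_mul_of_nonneg_left
      (weightedDist_triangle (wp := wp) (wm := wm) ξ ζ (ξs i)) hl
    change g ζ = G i ζ at hi
    rw [hi]
    simp only [G] at h1 ⊢
    linarith
  have hfg : ∀ ξ, D.recourse x ξ ≤ (g ξ : EReal) := fun ξ => by
    obtain ⟨i, -, hi⟩ := Finset.exists_mem_eq_inf' hne fun i => G i ξ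
    change g ξ = G i ξ at hi
    rw [hi]
    exact D.recourse_le_add_weightedDist hQ hwp hwm h ξ i
  have hsamples : (I : ℝ)⁻¹ * ∑ i, g (ξs i) ≤ (I : ℝ)⁻¹ * ∑ i, D.q ⬝ᵥ y i := by
    refine mul_le_mul_of_nonneg_left (Finset.sum_le_sum fun i _ => ?_) (by positivity)
    simpa [G, weightedDist_self] using hgG i (ξs i)
  have hwc : D.worstCase (wassersteinBall Set.univ (weightedDist wp wm) 1 (empirical ξs) ε) x ≤
      (((I : ℝ)⁻¹ * ∑ i, D.q ⬝ᵥ y i + l * ε : ℝ) : EReal) := by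
    refine iSup₂_le fun P hP => ?_
    have := hP.1.1
    have hGi : ∀ i, Integrable (G i) P := fun i => (integrable_const _).add
      ((integrable_weightedDist_of_mem_momentClass hwp.le hwm.le hP.1 (ξs i)).const_mul l)
    obtain ⟨c, hc⟩ : ∃ c : ℝ, ∀ ξ, c ≤ g ξ := by
      refine ⟨Finset.univ.inf' hne fun i => D.q ⬝ᵥ y i, fun ξ => ?_⟩
      refine Finset.le_inf' _ _ fun i _ => (Finset.inf'_le _ (Finset.mem_univ i)).trans ?_
      exact le_add_of_nonneg_right (mul_nonneg hl (weightedDist_nonneg hwp.le hwm.le _ _))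
    have hg : Integrable g P := by
      refine integrable_of_le_of_le hgc.aestronglyMeasurable (ae_of_all _ hc)
        (ae_of_all _ (hgG ⟨0, hI⟩)) (integrable_const c) (hGi _)
    refine (expectation_le_integral hg hfg).trans (EReal.coe_le_coe_iff.2 ?_)
    have := integral_le_of_mem_wassersteinBall hI hwp.le hwm.le hε ξs hP hgc hg hl hlip
    linarith
  refine (add_le_add_right hwc _).trans (le_of_eq ?_)
  rw [← EReal.coe_add]
  simp only [lpObjective, one_div]
  congr 1
  ring

/-- Lower bounds on the worst case by means of partial translations of the samples. -/
theorem le_worstCase_partialShift (hI : 0 < I)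
    (ξs : Fin I → Fin K → ℝ) {β : ℝ} (hβ : 0 ≤ β) (hβ1 : β ≤ 1) {v : Fin K → ℝ}
    (hv : β * weightedDist wp wm v 0 ≤ ε) {x : Fin N₁ → ℝ} {g : (Fin K → ℝ) → ℝ}
    (hg : ∀ ξ, (g ξ : EReal) ≤ D.recourse x ξ) :
    (((1 - β) * ((I : ℝ)⁻¹ * ∑ i, g (ξs i)) + β * ((I : ℝ)⁻¹ * ∑ i, g (ξs i + v)) : ℝ) : EReal) ≤
      D.worstCase (wassersteinBall Set.univ (weightedDist wp wm) 1 (empirical ξs) ε) x := by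
  rw [← integral_partialShift hI ξs hβ hβ1]
  exact (integral_le_expectation (integrable_partialShift hI ξs β v g) hg).trans
    (le_iSup₂_of_le _ (partialShift_mem_wassersteinBall hI ξs hβ hβ1 v hv) le_rfl)

/-- If the worst case is bounded by a real number, then every sample has a recourse decision. -/
theorem recourse_sample_ne_top (hI : 0 < I) (hQ : D.Q = 0)
    (hε : 0 ≤ ε) {p : Fin M → ℝ} (hp : 0 ≤ p) (hpq : D.Wᵀ *ᵥ p = D.q)
    (ξs : Fin I → Fin K → ℝ) {x : Fin N₁ → ℝ} {S : ℝ}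
    (hS : D.worstCase (wassersteinBall Set.univ (weightedDist wp wm) 1 (empirical ξs) ε) x ≤ S)
    (i : Fin I) : D.recourse x (ξs i) ≠ ⊤ := by
  classical
  intro htop
  let a : (Fin K → ℝ) → ℝ := fun ξ => p ⬝ᵥ (D.T x *ᵥ ξ + D.h x)
  have hI' : (0 : ℝ) < I := by exact_mod_cast hI
  -- Raising the dual minorant by `R` at an infeasible sample lifts the sum over the samples to at
  -- least `I (S + 1)`, contradicting the bound `S` for the empirical distribution itself (`β = 0`).
  let R : ℝ := |I * (S + 1) - ∑ j, a (ξs j)|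
  let g : (Fin K → ℝ) → ℝ := fun ξ => a ξ + if ξ = ξs i then R else 0
  have hg : ∀ ξ, (g ξ : EReal) ≤ D.recourse x ξ := fun ξ => by
    by_cases hξ : ξ = ξs i
    · rw [hξ, htop]; exact le_top
    · simpa only [g, if_neg hξ, add_zero] using D.le_recourse hQ hp hpq x ξ
  have h := (D.le_worstCase_partialShift hI ξs le_rfl zero_le_one (v := 0)
    (by simpa using hε) hg).trans hS
  rw [EReal.coe_le_coe_iff] at h
  simp only [sub_zero, one_mul, zero_mul, add_zero] at h
  rw [inv_mul_le_iff₀ hI', Finset.sum_add_distrib] at h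
  have h1 : R ≤ ∑ j, if ξs j = ξs i then R else 0 := by
    have := Finset.single_le_sum (f := fun j => if ξs j = ξs i then R else 0)
      (fun j _ => by split_ifs; exacts [abs_nonneg _, le_rfl]) (Finset.mem_univ i)
    simpa using this
  have h2 : I * (S + 1) - ∑ j, a (ξs j) ≤ R := le_abs_self _
  linarith

/-- The directional decisions of the linear program exist and their cost is controlled by the
worst case. -/
theorem exists_direction (hI : 0 < I) (hQ : D.Q = 0)
    (hε : 0 < ε) (hdual : ∃ p : Fin M → ℝ, 0 ≤ p ∧ D.Wᵀ *ᵥ p = D.q)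
    (ξs : Fin I → Fin K → ℝ) {x : Fin N₁ → ℝ} {S : ℝ}
    (hS : D.worstCase (wassersteinBall Set.univ (weightedDist wp wm) 1 (empirical ξs) ε) x ≤ S)
    {z : Fin I → ℝ} (hz : ∀ i, D.recourse x (ξs i) = (z i : EReal))
    {v : Fin K → ℝ} (hv : weightedDist wp wm v 0 = 1) :
    ∃ φ : Fin N₂ → ℝ, D.T x *ᵥ v ≤ D.W *ᵥ φ ∧
      D.q ⬝ᵥ φ ≤ (S - (I : ℝ)⁻¹ * ∑ i, z i) / ε := by
  classical
  refine exists_le_mulVec_of_forall_dual_le _ _ _ _ hdual fun p hp hpq => ?_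
  have hI' : (0 : ℝ) < I := by exact_mod_cast hI
  let a : (Fin K → ℝ) → ℝ := fun ξ => p ⬝ᵥ (D.T x *ᵥ ξ + D.h x)
  have ha : ∀ ξ, (a ξ : EReal) ≤ D.recourse x ξ := D.le_recourse hQ hp hpq x
  -- Exact recourse value at the samples, dual minorant elsewhere: the first serves the mass that
  -- stays, the second the mass that moves.
  let g : (Fin K → ℝ) → ℝ := fun ξ => if ∃ i, ξs i = ξ then (D.recourse x ξ).toReal else a ξ
  have hgs : ∀ i, g (ξs i) = z i := fun i => by
    have : ∃ j, ξs j = ξs i := ⟨i, rfl⟩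
    simp only [g, if_pos this, hz, EReal.toReal_coe]
  have hg : ∀ ξ, (g ξ : EReal) ≤ D.recourse x ξ := fun ξ => by
    by_cases hξ : ∃ i, ξs i = ξ
    · obtain ⟨i, rfl⟩ := hξ
      rw [hgs, hz]
    · simpa only [g, if_neg hξ] using ha ξ
  have hag : ∀ ξ, a ξ ≤ g ξ := fun ξ => by
    by_cases hξ : ∃ i, ξs i = ξ
    · obtain ⟨i, rfl⟩ := hξ
      rw [hgs, ← EReal.coe_le_coe_iff, ← hz]
      exact ha _
    · simp only [g, if_neg hξ, le_refl]
  set A : ℝ := (I : ℝ)⁻¹ * ∑ i, z i with hA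
  set C : ℝ := (I : ℝ)⁻¹ * ∑ i, a (ξs i) with hC
  have hadd : ∀ ξ (t : ℝ), a (ξ + t • v) = a ξ + t * (p ⬝ᵥ (D.T x *ᵥ v)) := fun ξ t => by
    simp only [a, mulVec_add, mulVec_smul, dotProduct_add, dotProduct_smul, smul_eq_mul]
    ring
  -- A fraction `1 / (n + 1)` of the mass travels a distance `(n + 1) ε`, for total cost `ε`. The
  -- gain `ε p ⬝ᵥ (T v)` does not depend on `n`, while the error `(C - A) / (n + 1)` vanishes in the
  -- limit.
  have key : ∀ n : ℕ, A + 1 / ((n : ℝ) + 1) * (C - A) + ε * (p ⬝ᵥ (D.T x *ᵥ v)) ≤ S := by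
    intro n
    have hn : (0 : ℝ) < (n : ℝ) + 1 := by positivity
    set β : ℝ := 1 / ((n : ℝ) + 1) with hβ
    have hβ0 : 0 ≤ β := by positivity
    have hβ1 : β ≤ 1 := by
      rw [hβ, div_le_one hn]
      linarith [n.cast_nonneg (α := ℝ)]
    have hβn : β * (((n : ℝ) + 1) * ε) = ε := by
      rw [hβ]; field_simp
    have hd : weightedDist wp wm ((((n : ℝ) + 1) * ε) • v) 0 = ((n : ℝ) + 1) * ε := by
      have := weightedDist_add_smul (wp := wp) (wm := wm) (t := ((n : ℝ) + 1) * ε)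
        (by positivity) 0 v
      rwa [zero_add, hv, mul_one] at this
    have h := (D.le_worstCase_partialShift hI ξs hβ0 hβ1
      (v := (((n : ℝ) + 1) * ε) • v) (by rw [hd, hβn]) hg).trans hS
    rw [EReal.coe_le_coe_iff] at h
    simp only [hgs, ← hA] at h
    have h1 : C + ((n : ℝ) + 1) * ε * (p ⬝ᵥ (D.T x *ᵥ v)) ≤
        (I : ℝ)⁻¹ * ∑ i, g (ξs i + (((n : ℝ) + 1) * ε) • v) := by
      have h2 : C + ((n : ℝ) + 1) * ε * (p ⬝ᵥ (D.T x *ᵥ v)) =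
          (I : ℝ)⁻¹ * ∑ i, a (ξs i + (((n : ℝ) + 1) * ε) • v) := by
        simp only [hadd, Finset.sum_add_distrib, Finset.sum_const, Finset.card_univ,
          Fintype.card_fin, nsmul_eq_mul, hC]
        field_simp
      rw [h2]
      exact mul_le_mul_of_nonneg_left (Finset.sum_le_sum fun i _ => hag _) (by positivity)
    have h3 := mul_le_mul_of_nonneg_left h1 hβ0
    have h4 : β * (C + ((n : ℝ) + 1) * ε * (p ⬝ᵥ (D.T x *ᵥ v))) =
        β * C + β * (((n : ℝ) + 1) * ε) * (p ⬝ᵥ (D.T x *ᵥ v)) := by ring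
    rw [h4, hβn] at h3
    linarith
  have hlim : Filter.Tendsto
      (fun n : ℕ => A + 1 / ((n : ℝ) + 1) * (C - A) + ε * (p ⬝ᵥ (D.T x *ᵥ v))) Filter.atTop
      (nhds (A + 0 * (C - A) + ε * (p ⬝ᵥ (D.T x *ᵥ v)))) :=
    ((tendsto_one_div_add_atTop_nhds_zero_nat.mul_const _).const_add _).add_const _
  have := le_of_tendsto' hlim key
  rw [le_div_iff₀ hε]
  linarith

/-- A finite objective value is attained in the linear program. -/
theorem exists_lpObjective_eq_objective (hI : 0 < I) (hQ : D.Q = 0) (hwp : 0 < wp)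
    (hwm : 0 < wm) (hε : 0 < ε) (hdual : ∃ p : Fin M → ℝ, 0 ≤ p ∧ D.Wᵀ *ᵥ p = D.q)
    (ξs : Fin I → Fin K → ℝ) {x : Fin N₁ → ℝ}
    (hx : D.objective (wassersteinBall Set.univ (weightedDist wp wm) 1 (empirical ξs) ε) x ≠ ⊤) :
    ∃ v : LPVar N₁ N₂ K I, D.LPConstraints wp wm ξs v ∧ v.1 = x ∧
      ((D.lpObjective ε v : ℝ) : EReal) =
        D.objective (wassersteinBall Set.univ (weightedDist wp wm) 1 (empirical ξs) ε) x := by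
  obtain ⟨p, hp, hpq⟩ := hdual
  set w := D.worstCase (wassersteinBall Set.univ (weightedDist wp wm) 1 (empirical ξs) ε) x with hw
  have hobj : D.objective (wassersteinBall Set.univ (weightedDist wp wm) 1 (empirical ξs) ε) x =
    ((D.c ⬝ᵥ x : ℝ) : EReal) + w := rfl
  have hwtop : w ≠ ⊤ := fun h => hx (by rw [hobj, h]; exact EReal.coe_add_top _)
  have hwbot : w ≠ ⊥ := fun h => by
    have := D.le_worstCase_partialShift (wp := wp) (wm := wm) hI ξs le_rfl zero_le_one (v := 0)
      (by simpa using hε.le) (D.le_recourse hQ hp hpq x)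
    rw [← hw, h] at this
    exact EReal.coe_ne_bot _ (le_bot_iff.1 this)
  obtain ⟨S, hS⟩ : ∃ S : ℝ, w = (S : EReal) := ⟨w.toReal, (EReal.coe_toReal hwtop hwbot).symm⟩
  have hwS := hS.le
  have hrtop := D.recourse_sample_ne_top hI hQ hε.le hp hpq ξs hwS
  have hrbot : ∀ i, D.recourse x (ξs i) ≠ ⊥ := fun i h => by
    have := D.le_recourse hQ hp hpq x (ξs i)
    rw [h] at this
    exact EReal.coe_ne_bot _ (le_bot_iff.1 this)
  let z : Fin I → ℝ := fun i => (D.recourse x (ξs i)).toReal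
  have hz : ∀ i, D.recourse x (ξs i) = (z i : EReal) := fun i =>
    (EReal.coe_toReal (hrtop i) (hrbot i)).symm
  have hy : ∀ i, ∃ y : Fin N₂ → ℝ, D.T x *ᵥ ξs i + D.h x ≤ D.W *ᵥ y ∧ D.q ⬝ᵥ y ≤ z i := fun i =>
    exists_le_mulVec_of_forall_dual_le _ _ _ _ ⟨p, hp, hpq⟩ fun p' hp' hpq' => by
      rw [← EReal.coe_le_coe_iff, ← hz]
      exact D.le_recourse hQ hp' hpq' x _
  choose y hyf hyz using hy
  have hyz' : ∀ i, D.q ⬝ᵥ y i = z i := fun i => le_antisymm (hyz i) (by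
    rw [← EReal.coe_le_coe_iff, ← hz]
    exact D.recourse_le hQ (hyf i))
  choose φ hφf hφl using fun k => D.exists_direction hI hQ hε ⟨p, hp, hpq⟩ ξs hwS hz
    (weightedDist_single_pos hwp hwm k)
  choose ψ hψf hψl using fun k => D.exists_direction hI hQ hε ⟨p, hp, hpq⟩ ξs hwS hz
    (weightedDist_single_neg hwp hwm k)
  -- The empirical distribution lies in the ball, so the sample average of the recourse values is at
  -- most `S`.
  have hl : 0 ≤ (S - (I : ℝ)⁻¹ * ∑ i, z i) / ε := by
    classical
    refine div_nonneg (sub_nonneg.2 ?_) hε.le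
    let g : (Fin K → ℝ) → ℝ := fun ξ =>
      if ∃ i, ξs i = ξ then (D.recourse x ξ).toReal else p ⬝ᵥ (D.T x *ᵥ ξ + D.h x)
    have hgs : ∀ i, g (ξs i) = z i := fun i => by
      have : ∃ j, ξs j = ξs i := ⟨i, rfl⟩
      simp only [g, if_pos this, hz, EReal.toReal_coe]
    have hg : ∀ ξ, (g ξ : EReal) ≤ D.recourse x ξ := fun ξ => by
      by_cases hξ : ∃ i, ξs i = ξ
      · obtain ⟨i, rfl⟩ := hξ
        rw [hgs, hz]
      · simpa only [g, if_neg hξ] using D.le_recourse hQ hp hpq x ξ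
    have h := (D.le_worstCase_partialShift hI ξs le_rfl zero_le_one (v := 0)
      (by simpa using hε.le) hg).trans hwS
    rw [EReal.coe_le_coe_iff] at h
    simpa [hgs] using h
  -- This `λ` makes `ε λ` plus the sample average equal to `S`, so the cost is exact.
  refine ⟨(x, (S - (I : ℝ)⁻¹ * ∑ i, z i) / ε, y, φ, ψ), ⟨hl, hyf, fun k => ⟨hφl k, hψl k, ?_, ?_⟩⟩,
    rfl, ?_⟩
  · rw [← mulVec_smul]; exact hφf k
  · rw [← mulVec_smul, ← mulVec_neg]; exact hψf k
  · rw [hobj, hS, ← EReal.coe_add]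
    simp only [lpObjective, hyz']
    congr 1
    field_simp
    ring

end Problem

end TwoStage

namespace TwoStage

/-! ### Coordinates and the size of the linear program -/

section Coordinates

variable {V : Type*} [AddCommGroup V] [Module ℝ V] {n : ℕ}

theorem exists_dotProduct_eq (e : V ≃ₗ[ℝ] (Fin n → ℝ)) (f : V →ₗ[ℝ] ℝ) :
    ∃ a : Fin n → ℝ, ∀ v, f v = a ⬝ᵥ e v := by
  refine ⟨fun i => f (e.symm (Pi.single i 1)), fun v => ?_⟩
  have h := LinearMap.pi_apply_eq_sum_univ (f ∘ₗ e.symm.toLinearMap) (e v)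
  simp only [LinearMap.comp_apply, LinearEquiv.coe_coe, LinearEquiv.symm_apply_apply] at h
  rw [h, dotProduct]
  refine Finset.sum_congr rfl fun i _ => ?_
  rw [smul_eq_mul, mul_comm]
  congr 3
  ext j
  simp [Pi.single_apply, eq_comm]

/-- A finite system of affine inequalities is a system `A v ≤ b` in coordinates. -/
theorem exists_mulVec_le_iff {J : Type*} [Fintype J] {m : ℕ} (hJ : Fintype.card J = m)
    (e : V ≃ₗ[ℝ] (Fin n → ℝ)) (F : J → V →ᵃ[ℝ] ℝ) :
    ∃ (A : Matrix (Fin m) (Fin n) ℝ) (b : Fin m → ℝ), ∀ v, (∀ j, F j v ≤ 0) ↔ A *ᵥ e v ≤ b := by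
  choose a ha using fun j => exists_dotProduct_eq e (F j).linear
  let r : J ≃ Fin m := Fintype.equivFinOfCardEq hJ
  refine ⟨Matrix.of fun j => a (r.symm j), fun j => -F (r.symm j) 0, fun v => ?_⟩
  have hF : ∀ j, F j v = a j ⬝ᵥ e v + F j 0 := fun j => by
    rw [← ha, AffineMap.decomp' (F j)]
    simp
  rw [Pi.le_def, ← r.symm.forall_congr_right]
  refine forall_congr' fun j => ?_
  rw [hF]
  change _ ↔ a (r.symm j) ⬝ᵥ e v ≤ _
  constructor <;> intro h <;> linarith

end Coordinates

namespace Problem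

variable {N₁ N₂ M K I : ℕ} (D : Problem N₁ N₂ M K)

theorem finrank_lpVar :
    Module.finrank ℝ (LPVar N₁ N₂ K I) = N₁ + 1 + I * N₂ + 2 * (K * N₂) := by
  simp [LPVar, Module.finrank_prod, Module.finrank_pi_fintype]
  ring

/-- Coordinates on the space of decision variables of the linear program. -/
noncomputable def lpCoordinates :
    LPVar N₁ N₂ K I ≃ₗ[ℝ] (Fin (N₁ + 1 + I * N₂ + 2 * (K * N₂)) → ℝ) :=
  LinearEquiv.ofFinrankEq _ _ (by rw [finrank_lpVar]; simp)

theorem exists_lpObjective_eq_dotProduct (ε : ℝ)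
    (e : LPVar N₁ N₂ K I ≃ₗ[ℝ] (Fin (N₁ + 1 + I * N₂ + 2 * (K * N₂)) → ℝ)) :
    ∃ cost : Fin (N₁ + 1 + I * N₂ + 2 * (K * N₂)) → ℝ, ∀ v, D.lpObjective ε v = cost ⬝ᵥ e v := by
  let f : LPVar N₁ N₂ K I →ₗ[ℝ] ℝ :=
    { toFun := D.lpObjective ε
      map_add' := by
        rintro ⟨x, l, y, φ, ψ⟩ ⟨x', l', y', φ', ψ'⟩
        simp only [lpObjective, Pi.add_apply, dotProduct_add,
          Finset.sum_add_distrib]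
        ring
      map_smul' := by
        rintro t ⟨x, l, y, φ, ψ⟩
        simp only [lpObjective, Prod.smul_mk, Pi.smul_apply, dotProduct_smul, smul_eq_mul,
          ← Finset.mul_sum, RingHom.id_apply]
        ring }
  exact exists_dotProduct_eq e f

/-- The affine functions whose nonpositivity expresses the constraints of the linear program. -/
theorem exists_affine_lpConstraints (wp wm : ℝ) (ξs : Fin I → Fin K → ℝ) :
    ∃ F : (Unit ⊕ Fin I × Fin M) ⊕ (Fin K × (Unit ⊕ Fin M)) ⊕ (Fin K × (Unit ⊕ Fin M)) →
        LPVar N₁ N₂ K I →ᵃ[ℝ] ℝ,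
      ∀ v, D.LPConstraints wp wm ξs v ↔ ∀ j, F j v ≤ 0 := by
  let px : LPVar N₁ N₂ K I →ₗ[ℝ] (Fin N₁ → ℝ) := LinearMap.fst ℝ _ _
  let pl : LPVar N₁ N₂ K I →ₗ[ℝ] ℝ := LinearMap.fst ℝ _ _ ∘ₗ LinearMap.snd ℝ _ _
  let py : LPVar N₁ N₂ K I →ₗ[ℝ] (Fin I → Fin N₂ → ℝ) :=
    LinearMap.fst ℝ _ _ ∘ₗ LinearMap.snd ℝ _ _ ∘ₗ LinearMap.snd ℝ _ _
  let pφ : LPVar N₁ N₂ K I →ₗ[ℝ] (Fin K → Fin N₂ → ℝ) :=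
    LinearMap.fst ℝ _ _ ∘ₗ LinearMap.snd ℝ _ _ ∘ₗ LinearMap.snd ℝ _ _ ∘ₗ LinearMap.snd ℝ _ _
  let pψ : LPVar N₁ N₂ K I →ₗ[ℝ] (Fin K → Fin N₂ → ℝ) :=
    LinearMap.snd ℝ _ _ ∘ₗ LinearMap.snd ℝ _ _ ∘ₗ LinearMap.snd ℝ _ _ ∘ₗ LinearMap.snd ℝ _ _
  let qL : (Fin N₂ → ℝ) →ₗ[ℝ] ℝ := ∑ j, D.q j • LinearMap.proj j
  have hqL : ∀ y, qL y = D.q ⬝ᵥ y := fun y => by simp [qL, dotProduct]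
  let Wr : Fin M → (Fin N₂ → ℝ) →ₗ[ℝ] ℝ := fun r => LinearMap.proj r ∘ₗ D.W.mulVecLin
  -- For fixed `ξ`, an entry of `T(x) ξ` is linear in the matrix `T(x)`, hence affine in `x`.
  let Tr : (Fin K → ℝ) → Fin M → LPVar N₁ N₂ K I →ᵃ[ℝ] ℝ := fun ξ r =>
    (LinearMap.proj r ∘ₗ (Matrix.mulVecBilin ℝ ℝ).flip ξ).toAffineMap.comp
      (D.T.comp px.toAffineMap)
  have hTr : ∀ ξ r v, Tr ξ r v = (D.T v.1 *ᵥ ξ) r := fun ξ r v => rfl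
  let hr : Fin M → LPVar N₁ N₂ K I →ᵃ[ℝ] ℝ := fun r =>
    (LinearMap.proj (R := ℝ) (φ := fun _ : Fin M => ℝ) r).toAffineMap.comp
      (D.h.comp px.toAffineMap)
  refine ⟨Sum.elim
    (Sum.elim (fun _ => (-pl).toAffineMap) fun ir =>
      Tr (ξs ir.1) ir.2 + hr ir.2 - (Wr ir.2 ∘ₗ LinearMap.proj ir.1 ∘ₗ py).toAffineMap)
    (Sum.elim
      (fun ks => Sum.elim (fun _ => (qL ∘ₗ LinearMap.proj ks.1 ∘ₗ pφ - pl).toAffineMap)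
        (fun r => wp⁻¹ • Tr (Pi.single ks.1 1) r -
          (Wr r ∘ₗ LinearMap.proj ks.1 ∘ₗ pφ).toAffineMap) ks.2)
      fun ks => Sum.elim (fun _ => (qL ∘ₗ LinearMap.proj ks.1 ∘ₗ pψ - pl).toAffineMap)
        (fun r => -(wm⁻¹ • Tr (Pi.single ks.1 1) r) -
          (Wr r ∘ₗ LinearMap.proj ks.1 ∘ₗ pψ).toAffineMap) ks.2), ?_⟩
  rintro ⟨x, l, y, φ, ψ⟩
  simp only [Sum.forall, Prod.forall, Sum.elim_inl, Sum.elim_inr, LPConstraints]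
  simp [px, pl, py, pφ, pψ, hqL, Wr, hTr, hr, Pi.le_def, forall_and]
  tauto

theorem card_lpConstraints (I M K : ℕ) :
    Fintype.card ((Unit ⊕ Fin I × Fin M) ⊕ (Fin K × (Unit ⊕ Fin M)) ⊕
      (Fin K × (Unit ⊕ Fin M))) = 1 + I * M + 2 * (K * (1 + M)) := by
  simp
  ring

end Problem

end TwoStage

/-! ### Equivalence of the two problems -/

theorem mainTheorem7 {N₁ N₂ M K I : ℕ} (hI : 0 < I)
    (D : TwoStage.Problem N₁ N₂ M K) (hQ : D.Q = 0) (hΞ : D.Ξ = Set.univ)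
    (wp wm : ℝ) (hwp : 0 < wp) (hwm : 0 < wm) (ε : ℝ) (hε : 0 < ε)
    (ξs : Fin I → Fin K → ℝ) (hrec : D.SufficientlyExpensiveRecourse)
    (Amb : Set (MeasureTheory.Measure (Fin K → ℝ)))
    (hAmb : Amb = TwoStage.wassersteinBall D.Ξ (TwoStage.weightedDist wp wm) 1
      (TwoStage.empirical ξs) ε) :
    -- for every fixed here-and-now decision the optimal values agree
    (∀ x ∈ D.X, D.objective Amb x =
      ⨅ v ∈ {v : TwoStage.Problem.LPVar N₁ N₂ K I | D.LPFeasible wp wm ξs v ∧ v.1 = x},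
        ((D.lpObjective ε v : ℝ) : EReal)) ∧
    -- and every finite value is attained in the linear program
    (∀ x ∈ D.X, D.objective Amb x ≠ ⊤ →
      ∃ v : TwoStage.Problem.LPVar N₁ N₂ K I, D.LPFeasible wp wm ξs v ∧ v.1 = x ∧
        ((D.lpObjective ε v : ℝ) : EReal) = D.objective Amb x) ∧
    -- the optimal values of the two problems agree
    (⨅ x ∈ D.X, D.objective Amb x) =
      (⨅ v ∈ {v : TwoStage.Problem.LPVar N₁ N₂ K I | D.LPFeasible wp wm ξs v},
        ((D.lpObjective ε v : ℝ) : EReal)) ∧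
    -- the optimal here-and-now decisions of the two problems agree
    (∀ x, D.IsOptimal Amb x ↔
      ∃ v : TwoStage.Problem.LPVar N₁ N₂ K I, D.LPOptimal wp wm ξs ε v ∧ v.1 = x) ∧
    -- size: in coordinates `e`, a linear objective in `N₁ + 1 + I N₂ + 2 K N₂` real variables and
    -- `1 + I M + 2 K (1 + M)` linear inequalities in addition to those that describe `X`
    (∃ (e : TwoStage.Problem.LPVar N₁ N₂ K I ≃ₗ[ℝ]
          (Fin (N₁ + 1 + I * N₂ + 2 * (K * N₂)) → ℝ))
        (cost : Fin (N₁ + 1 + I * N₂ + 2 * (K * N₂)) → ℝ),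
      (∀ v, D.lpObjective ε v = cost ⬝ᵥ e v) ∧
      (∃ (A : Matrix (Fin (1 + I * M + 2 * (K * (1 + M))))
            (Fin (N₁ + 1 + I * N₂ + 2 * (K * N₂))) ℝ)
          (b : Fin (1 + I * M + 2 * (K * (1 + M))) → ℝ),
        ∀ v, D.LPConstraints wp wm ξs v ↔ A *ᵥ e v ≤ b) ∧
      (∀ (m₀ : ℕ) (A₀ : Matrix (Fin m₀) (Fin N₁) ℝ) (b₀ : Fin m₀ → ℝ),
        D.X = {x | A₀ *ᵥ x ≤ b₀} →
        ∃ (A : Matrix (Fin (m₀ + (1 + I * M + 2 * (K * (1 + M)))))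
            (Fin (N₁ + 1 + I * N₂ + 2 * (K * N₂))) ℝ)
          (b : Fin (m₀ + (1 + I * M + 2 * (K * (1 + M)))) → ℝ),
          ∀ v, D.LPFeasible wp wm ξs v ↔ A *ᵥ e v ≤ b)) := by
  rw [hΞ] at hAmb
  subst hAmb
  -- With `Q = 0` the dual feasible set does not depend on `ξ`, so `ξ = 0` suffices.
  have hdual : ∃ p : Fin M → ℝ, 0 ≤ p ∧ D.Wᵀ *ᵥ p = D.q := by
    obtain ⟨p, hp, hpq⟩ := hrec 0 (hΞ ▸ Set.mem_univ _)
    exact ⟨p, hp, by rw [← hpq, hQ, zero_mulVec, zero_add]⟩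
  have hle : ∀ v : TwoStage.Problem.LPVar N₁ N₂ K I, D.LPFeasible wp wm ξs v →
      D.objective (TwoStage.wassersteinBall Set.univ (TwoStage.weightedDist wp wm) 1
        (TwoStage.empirical ξs) ε) v.1 ≤ ((D.lpObjective ε v : ℝ) : EReal) := fun v hv =>
    D.objective_le_lpObjective hI hQ hwp hwm hε.le hv.2
  have hatt : ∀ x ∈ D.X, D.objective (TwoStage.wassersteinBall Set.univ
      (TwoStage.weightedDist wp wm) 1 (TwoStage.empirical ξs) ε) x ≠ ⊤ →
      ∃ v : TwoStage.Problem.LPVar N₁ N₂ K I, D.LPFeasible wp wm ξs v ∧ v.1 = x ∧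
        ((D.lpObjective ε v : ℝ) : EReal) = D.objective (TwoStage.wassersteinBall Set.univ
          (TwoStage.weightedDist wp wm) 1 (TwoStage.empirical ξs) ε) x := fun x hx hx' => by
    obtain ⟨v, hv, rfl, hv'⟩ := D.exists_lpObjective_eq_objective hI hQ hwp hwm hε hdual ξs hx'
    exact ⟨v, ⟨hx, hv⟩, rfl, hv'⟩
  refine ⟨fun x hx => le_antisymm ?_ ?_, hatt, le_antisymm ?_ ?_, fun x => ⟨?_, ?_⟩, ?_⟩
  · refine le_iInf₂ fun v hv => ?_
    rw [← hv.2]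
    exact hle v hv.1
  -- Nothing is to be shown when the objective is `⊤`; otherwise the attaining point gives the
  -- bound. The same argument serves for the optimal values.
  · by_contra hlt
    obtain ⟨v, hv, hvx, hv'⟩ := hatt x hx fun h => hlt (h ▸ le_top)
    exact hlt ((iInf₂_le v ⟨hv, hvx⟩).trans hv'.le)
  · exact le_iInf₂ fun v hv => (iInf₂_le v.1 hv.1).trans (hle v hv)
  · refine le_iInf₂ fun x hx => ?_
    by_contra hlt
    obtain ⟨v, hv, -, hv'⟩ := hatt x hx fun h => hlt (h ▸ le_top)
    exact hlt ((iInf₂_le v hv).trans hv'.le)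
  · rintro ⟨hx, htop, hopt⟩
    obtain ⟨v, hv, hvx, hv'⟩ := hatt x hx htop
    refine ⟨v, ⟨hv, fun v' hv'' => ?_⟩, hvx⟩
    rw [← EReal.coe_le_coe_iff, hv']
    exact (hopt v'.1 hv''.1).trans (hle v' hv'')
  · rintro ⟨v, ⟨hv, hopt⟩, rfl⟩
    -- Any feasible point of the linear program forces the objective below `⊤`.
    refine ⟨hv.1, ((hle v hv).trans_lt (EReal.coe_lt_top _)).ne, fun x' hx' => ?_⟩
    by_contra hlt
    obtain ⟨v', hv', -, h⟩ := hatt x' hx' fun h => hlt (h ▸ le_top)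
    refine hlt ((hle v hv).trans ?_)
    rw [← h, EReal.coe_le_coe_iff]
    exact hopt v' hv'
  · obtain ⟨cost, hcost⟩ := D.exists_lpObjective_eq_dotProduct ε TwoStage.Problem.lpCoordinates
    obtain ⟨F, hF⟩ := D.exists_affine_lpConstraints wp wm ξs
    refine ⟨TwoStage.Problem.lpCoordinates, cost, hcost, ?_, fun m₀ A₀ b₀ hX => ?_⟩
    · obtain ⟨A, b, h⟩ := TwoStage.exists_mulVec_le_iff
        (TwoStage.Problem.card_lpConstraints I M K) TwoStage.Problem.lpCoordinates F
      exact ⟨A, b, fun v => (hF v).trans (h v)⟩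
    · let F₀ : Fin m₀ → TwoStage.Problem.LPVar N₁ N₂ K I →ᵃ[ℝ] ℝ := fun j =>
        (LinearMap.proj j ∘ₗ A₀.mulVecLin ∘ₗ LinearMap.fst ℝ _ _).toAffineMap -
          AffineMap.const ℝ _ (b₀ j)
      obtain ⟨A, b, h⟩ := TwoStage.exists_mulVec_le_iff (J := Fin m₀ ⊕ _)
        (by rw [Fintype.card_sum, TwoStage.Problem.card_lpConstraints, Fintype.card_fin])
        TwoStage.Problem.lpCoordinates (Sum.elim F₀ F)
      refine ⟨A, b, fun v => Iff.trans ?_ (h v)⟩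
      rw [Sum.forall]
      refine and_congr ?_ (hF v)
      rw [hX, Set.mem_ofPred_eq, Pi.le_def]
      exact forall_congr' fun j => sub_nonpos.symm
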